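/- There are absolute constants $\tau>0$ and $c>0$ such that the following holds for every integer $n\ge 3$ and every integer $d\ge 0$ with $d\le \tau\log n/\log\log n$ (natural logarithms). Let $m\ge 0$, let $\mathbf{Y}$ be uniformly distributed on $\{0,1\}^m$, and let $f\colon\{0,1\}^m\to\{0,1\}^n$ be computed by a decision forest of depth $d$, that is, each of the $n$ output bits of $f$ is computed by a decision tree that makes at most $d$ adaptive queries to the input bits. Then the distribution of $f(\mathbf{Y})$ is at statistical distance at least $1-n^{-c}$ from the uniform distribution $\mathbf{U}_1^n$ on the $n$-bit strings of Hamming weight $1$, where the statistical distance of two distributions $S,T$ on $\{0,1\}^n$ is $\Delta(S,T)=\frac12\sum_{a\in\{0,1\}^n}|S(a)-T(a)|$. -/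

import Mathlib

/-- A Boolean decision tree over `m` input bits: a leaf carries the output value, an inner node
queries one input bit and continues with the first subtree if the bit is `false` and with the
second one if it is `true`. -/
inductive DecisionTree (m : ℕ) : Type
  | leaf (b : Bool) : DecisionTree m
  | query (i : Fin m) (t₀ t₁ : DecisionTree m) : DecisionTree m

namespace DecisionTree

/-- The value computed by a decision tree on the input `x`. -/
def eval {m : ℕ} : DecisionTree m → (Fin m → Bool) → Bool
  | leaf b, _ => b
  | query i t₀ t₁, x => if x i = true then t₁.eval x else t₀.eval x

/-- The depth of a decision tree: the largest number of queries on a root-to-leaf path. -/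
def depth {m : ℕ} : DecisionTree m → ℕ
  | leaf _ => 0
  | query _ t₀ t₁ => max t₀.depth t₁.depth + 1

end DecisionTree

/-- `f : {0,1}^m → {0,1}^n` is computed by a decision forest of depth `d`: every output bit is
computed by a decision tree of depth at most `d` over the input bits. -/
def HasDecisionDepth {m n : ℕ} (f : (Fin m → Bool) → (Fin n → Bool)) (d : ℕ) : Prop :=
  ∃ T : Fin n → DecisionTree m, ∀ i, (T i).depth ≤ d ∧ ∀ x, f x i = (T i).eval x

/-- The distribution `p` on `{0,1}^n` is sampled by a decision forest of depth `d`: it is the law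
of `f(Y)` for some number `m` of input bits, `Y` uniform on `{0,1}^m`, and some `f` computed by a
decision forest of depth `d`. -/
def SampledWithDecisionDepth {n : ℕ} (p : PMF (Fin n → Bool)) (d : ℕ) : Prop :=
  ∃ (m : ℕ) (f : (Fin m → Bool) → (Fin n → Bool)),
    HasDecisionDepth f d ∧ p = (PMF.uniformOfFintype (Fin m → Bool)).map f

/-- Hamming weight of a bit string. -/
def bitWeight {n : ℕ} (x : Fin n → Bool) : ℕ :=
  (Finset.univ.filter fun i => x i = true).card

/-- The `k`-slice: all `n`-bit strings of Hamming weight `k`. -/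
def bitSlice (n k : ℕ) : Finset (Fin n → Bool) :=
  Finset.univ.filter fun x => bitWeight x = k

theorem bitSlice_nonempty {n k : ℕ} (h : k ≤ n) : (bitSlice n k).Nonempty := by
  obtain ⟨s, -, hs⟩ := Finset.exists_subset_card_eq
    (s := (Finset.univ : Finset (Fin n))) (n := k) (by simpa using h)
  exact ⟨fun i => decide (i ∈ s), Finset.mem_filter.2 ⟨Finset.mem_univ _, by simp [bitWeight, hs]⟩⟩

/-- The uniform distribution on the `n`-bit strings of Hamming weight `k`. -/
noncomputable def uniformSlice (n k : ℕ) (h : k ≤ n) : PMF (Fin n → Bool) :=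
  PMF.uniformOfFinset (bitSlice n k) (bitSlice_nonempty h)

/-- Statistical (total variation) distance of two distributions on a finite set. -/
noncomputable def statDist {α : Type*} [Fintype α] (p q : PMF α) : ℝ :=
  (1 / 2) * ∑ a, |(p a).toReal - (q a).toReal|

/-!
The distance of a distribution `p` from the uniform distribution on unit vectors is `1 - ∑ i,
min (p (e i)) (1 / n)`, so the point is to bound this overlap for the output of a shallow
forest. If the `i`-th tree outputs `1` on `y`, then the at most `d` bits which it reads on `y`
form a certificate: every input that agrees with `y` there makes the `i`-th output `1`. By
averaging, one input `y` can be fixed such that the indices `i`, weighted by (a capped version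
of) the probability that the output is `e i` and the input agrees with `y` on the `i`-th
certificate, carry at least a `2⁻ᵈ` fraction of the overlap.

Among the certificates of `y`, `exists_spread_kernel` finds a set `K` that is contained in
certificates of total weight at least an `R⁻ᵈ` fraction, and outside `K` these are spread: the
weight of the certificates that contain a further set `A` decays like `R ^ (-|A|)`. A spread
family of small sets has a member inside a uniformly random set except with probability `(3 / 4)
^ k`, where `R ≈ 4 d k` (`expect_miss_le`). To see this, view the random set as a union of `k`
independent sparse random sets; each of them contains a member with constant probability by the
second moment method (`biasExp_miss_le`).

This is applied to the set of bits on which a random input agrees with `y`. The output `e i`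
together with agreement on the `i`-th certificate means that every certificate above `K` other
than the `i`-th one is missed, so each such `i` has weight at most `(3 / 4) ^ k`. For `k` a
suitable multiple of `log n` these weights sum to at most `2 / n`, whereas the weight above `K`
is at least `(2 R)⁻ᵈ` times the overlap. Hence the overlap is at most `2 (2 R) ^ d / n`
(`sum_min_unitProb_le`). Since `R` is polylogarithmic in `n`, the bound on `d` makes `(2 R) ^ d`
a small power of `n`.
-/

open Finset
open scoped BigOperators

/-! ### Certificates read by a decision tree -/

namespace DecisionTree

variable {m : ℕ}

/-- The set of input bits that a decision tree reads on the input `x`. -/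
def queries : DecisionTree m → (Fin m → Bool) → Finset (Fin m)
  | leaf _, _ => ∅
  | query i t₀ t₁, x => insert i (if x i = true then t₁.queries x else t₀.queries x)

theorem card_queries_le (T : DecisionTree m) (x : Fin m → Bool) :
    (T.queries x).card ≤ T.depth := by
  induction T with
  | leaf b => simp [queries]
  | query i t₀ t₁ h₀ h₁ =>
    simp only [queries, depth]
    refine (card_insert_le _ _).trans (Nat.succ_le_succ ?_)
    split_ifs
    · exact h₁.trans (le_max_right _ _)
    · exact h₀.trans (le_max_left _ _)

/-- The bits read on the input `x` certify the whole computation: an input that agrees with `x` on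
them follows the same path. -/
theorem queries_eval_congr (T : DecisionTree m) {x y : Fin m → Bool}
    (h : ∀ j ∈ T.queries x, y j = x j) : T.queries y = T.queries x ∧ T.eval y = T.eval x := by
  induction T with
  | leaf b => simp [queries, eval]
  | query i t₀ t₁ h₀ h₁ =>
    have hi : y i = x i := h i (by simp [queries])
    simp only [queries, eval, hi]
    simp only [queries, mem_insert] at h
    split_ifs at h ⊢ with hx
    · obtain ⟨h2, h3⟩ := h₁ fun j hj => h j (Or.inr hj)
      exact ⟨by rw [h2], h3⟩
    · obtain ⟨h2, h3⟩ := h₀ fun j hj => h j (Or.inr hj)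
      exact ⟨by rw [h2], h3⟩

end DecisionTree

/-! ### Spread families and biased random sets -/

/-- For a spread weighted family, the members meeting a fixed small set in many points have little
weight: expand `(1 + s) ^ |B ∩ T i|` over the subsets of the intersection. -/
theorem sum_pow_inter_le {ι κ : Type*} [DecidableEq ι] {R s : ℝ} (hR : 0 < R) (hs : 0 ≤ s)
    (I : Finset κ) (v : κ → ℝ) (T : κ → Finset ι) {V : ℝ}
    (hspread : ∀ A : Finset ι, R ^ A.card * ∑ i ∈ I with A ⊆ T i, v i ≤ V) (B : Finset ι) :
    ∑ i ∈ I, v i * (1 + s) ^ (B ∩ T i).card ≤ (1 + s / R) ^ B.card * V := by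
  have hpow : ∀ (a : ℝ) (C : Finset ι), (1 + a) ^ C.card = ∑ A ∈ C.powerset, a ^ A.card := by
    intro a C
    rw [add_comm, ← Finset.sum_pow_mul_eq_add_pow]
    simp
  have hL : ∀ i, v i * (1 + s) ^ (B ∩ T i).card =
      ∑ A ∈ B.powerset, if A ⊆ T i then s ^ A.card * v i else 0 := by
    intro i
    rw [hpow, mul_sum, ← sum_filter]
    refine sum_congr ?_ fun _ _ => mul_comm _ _
    ext A
    rw [mem_powerset, subset_inter_iff, mem_filter, mem_powerset]
  simp only [hL]
  rw [sum_comm, hpow, sum_mul]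
  refine sum_le_sum fun A _ => ?_
  rw [← sum_filter, ← mul_sum, div_pow, div_mul_eq_mul_div, mul_div_assoc]
  refine mul_le_mul_of_nonneg_left ?_ (pow_nonneg hs _)
  rw [le_div_iff₀ (pow_pos hR _), mul_comm]
  exact hspread A

section Biased

variable {ι κ : Type*} [Fintype ι] [DecidableEq ι]

/-- The probability that a `p`-biased bit takes the value `b`. -/
noncomputable def bitProb (p : ℝ) (b : Bool) : ℝ := if b = true then p else 1 - p

/-- The expectation of `F` over independent `p`-biased bits indexed by `ι`. -/
noncomputable def biasExp (p : ℝ) (F : (ι → Bool) → ℝ) : ℝ :=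
  ∑ x, (∏ j, bitProb p (x j)) * F x

theorem bitProb_nonneg {p : ℝ} (h₀ : 0 ≤ p) (h₁ : p ≤ 1) (b : Bool) : 0 ≤ bitProb p b := by
  unfold bitProb; split_ifs <;> linarith

theorem biasExp_prod (p : ℝ) (g : ι → Bool → ℝ) :
    biasExp p (fun x => ∏ j, g j (x j)) = ∏ j, (p * g j true + (1 - p) * g j false) := by
  have : ∀ j, p * g j true + (1 - p) * g j false = ∑ b, bitProb p b * g j b := by
    intro j; simp [bitProb]
  simp only [this, Finset.prod_univ_sum, Fintype.piFinset_univ, biasExp, prod_mul_distrib]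

theorem biasExp_one (p : ℝ) : biasExp p (fun _ : ι → Bool => 1) = 1 := by
  simpa using biasExp_prod p (fun (_ : ι) _ => 1)

theorem biasExp_nonneg {p : ℝ} (h₀ : 0 ≤ p) (h₁ : p ≤ 1) {F : (ι → Bool) → ℝ}
    (h : ∀ x, 0 ≤ F x) : 0 ≤ biasExp p F :=
  sum_nonneg fun x _ => mul_nonneg (prod_nonneg fun _ _ => bitProb_nonneg h₀ h₁ _) (h x)

theorem biasExp_mono {p : ℝ} (h₀ : 0 ≤ p) (h₁ : p ≤ 1) {F G : (ι → Bool) → ℝ}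
    (h : ∀ x, F x ≤ G x) : biasExp p F ≤ biasExp p G :=
  sum_le_sum fun x _ => mul_le_mul_of_nonneg_left (h x)
    (prod_nonneg fun _ _ => bitProb_nonneg h₀ h₁ _)

theorem biasExp_sum (p : ℝ) (s : Finset κ) (F : κ → (ι → Bool) → ℝ) :
    biasExp p (fun x => ∑ i ∈ s, F i x) = ∑ i ∈ s, biasExp p (F i) := by
  simp only [biasExp, mul_sum]
  rw [sum_comm]

theorem biasExp_const_mul (p c : ℝ) (F : (ι → Bool) → ℝ) :
    biasExp p (fun x => c * F x) = c * biasExp p F := by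
  simp only [biasExp, mul_sum]
  exact sum_congr rfl fun _ _ => by ring

theorem biasExp_forall_mem (p : ℝ) (A : Finset ι) :
    biasExp p (fun x => if ∀ j ∈ A, x j = true then 1 else 0) = p ^ A.card := by
  have h : ∀ x : ι → Bool, (if ∀ j ∈ A, x j = true then (1 : ℝ) else 0) =
      ∏ j, (if j ∈ A → x j = true then 1 else 0) := by
    intro x; rw [Fintype.prod_ite_zero]; simp
  simp only [h]
  rw [biasExp_prod p (fun j b => if j ∈ A → b = true then 1 else 0)]
  have : ∀ j, (p * (if j ∈ A → true = true then 1 else 0) +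
      (1 - p) * (if j ∈ A → false = true then 1 else 0)) = if j ∈ A then p else 1 := by
    intro j; by_cases hj : j ∈ A <;> simp [hj]
  rw [prod_congr rfl fun j _ => this j]
  simp

/-- The bitwise disjunction of independent `p`-biased and `q`-biased strings is a
`p + q - p q`-biased string. -/
theorem biasExp_or (p q : ℝ) (F : (ι → Bool) → ℝ) :
    biasExp p (fun x => biasExp q fun y => F fun j => x j || y j) =
      biasExp (1 - (1 - p) * (1 - q)) F := by
  have key : ∀ u : ι → Bool, biasExp p (fun x => biasExp q fun y =>
      if (fun j => x j || y j) = u then 1 else 0) =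
      ∏ j, bitProb (1 - (1 - p) * (1 - q)) (u j) := by
    intro u
    have h : ∀ x y : ι → Bool, (if (fun j => x j || y j) = u then (1 : ℝ) else 0) =
        ∏ j, (if (x j || y j) = u j then 1 else 0) := by
      intro x y; rw [Fintype.prod_ite_zero]; simp [funext_iff]
    simp only [h]
    have h2 : ∀ x : ι → Bool, biasExp q (fun y => ∏ j, if (x j || y j) = u j then (1 : ℝ) else 0) =
        ∏ j, (q * (if (x j || true) = u j then 1 else 0) +
          (1 - q) * (if (x j || false) = u j then 1 else 0)) := fun x =>
      biasExp_prod q fun j b => if (x j || b) = u j then (1 : ℝ) else 0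
    simp only [h2]
    rw [biasExp_prod p fun j a => (q * (if (a || true) = u j then (1 : ℝ) else 0) +
          (1 - q) * (if (a || false) = u j then 1 else 0))]
    refine prod_congr rfl fun j _ => ?_
    cases u j <;> simp [bitProb]
    ring
  have hF : ∀ x : ι → Bool, F x = ∑ u, F u * if x = u then 1 else 0 := by
    intro x; simp
  have : ∀ x y : ι → Bool, F (fun j => x j || y j) =
      ∑ u, F u * if (fun j => x j || y j) = u then 1 else 0 := fun x y => hF _
  simp only [this, biasExp_sum, biasExp_const_mul, key]
  exact sum_congr rfl fun u _ => mul_comm _ _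

theorem biasExp_half (F : (ι → Bool) → ℝ) : biasExp (1 / 2) F = univ.expect F := by
  have : ∀ b, bitProb (1 / 2) b = 2⁻¹ := by intro b; unfold bitProb; split_ifs <;> norm_num
  simp only [biasExp, this, prod_const, Fintype.expect_eq_sum_div_card, sum_div]
  refine sum_congr rfl fun x _ => ?_
  simp [div_eq_inv_mul]

/-- A disjunction of `k` independent `p`-biased strings is `1 - (1 - p) ^ k`-biased, and it can miss
every set `T i` only if each of the `k` strings does. -/
theorem biasExp_miss_pow {p : ℝ} (h₀ : 0 ≤ p) (h₁ : p ≤ 1) (I : Finset κ) (T : κ → Finset ι)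
    (k : ℕ) :
    biasExp (1 - (1 - p) ^ k) (fun x => if ∃ i ∈ I, ∀ j ∈ T i, x j = true then 0 else 1) ≤
      biasExp p (fun x => if ∃ i ∈ I, ∀ j ∈ T i, x j = true then 0 else 1) ^ k := by
  induction k with
  | zero =>
    rw [pow_zero, pow_zero, sub_self]
    refine le_of_le_of_eq ?_ (biasExp_one (ι := ι) 0)
    refine biasExp_mono le_rfl zero_le_one fun x => ?_
    split_ifs
    · exact zero_le_one
    · exact le_rfl
  | succ k ih =>
    have hq₀ : 0 ≤ (1 - p) ^ k := pow_nonneg (by linarith) _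
    have hq₁ : (1 - p) ^ k ≤ 1 := pow_le_one₀ (by linarith) (by linarith)
    have e : 1 - (1 - p) ^ (k + 1) = 1 - (1 - (1 - (1 - p) ^ k)) * (1 - p) := by ring
    have hm : 0 ≤ biasExp p
        (fun x : ι → Bool => if ∃ i ∈ I, ∀ j ∈ T i, x j = true then (0 : ℝ) else 1) := by
      refine biasExp_nonneg h₀ h₁ fun x => ?_
      split_ifs <;> norm_num
    rw [e, ← biasExp_or, pow_succ]
    refine le_trans ?_ (mul_le_mul_of_nonneg_right ih hm)
    rw [mul_comm, ← biasExp_const_mul]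
    refine biasExp_mono (by linarith) (by linarith) fun x => ?_
    rw [mul_comm, ← biasExp_const_mul]
    refine biasExp_mono h₀ h₁ fun y => ?_
    by_cases hx : ∃ i ∈ I, ∀ j ∈ T i, x j = true
    · have : ∃ i ∈ I, ∀ j ∈ T i, (x j || y j) = true := by
        obtain ⟨i, hi, h⟩ := hx
        exact ⟨i, hi, fun j hj => by simp [h j hj]⟩
      rw [if_pos this, if_pos hx, zero_mul]
    · by_cases hy : ∃ i ∈ I, ∀ j ∈ T i, y j = true
      · have : ∃ i ∈ I, ∀ j ∈ T i, (x j || y j) = true := by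
          obtain ⟨i, hi, h⟩ := hy
          exact ⟨i, hi, fun j hj => by simp [h j hj]⟩
        rw [if_pos this, if_pos hy, mul_zero]
      · rw [if_neg hx, if_neg hy]
        split_ifs <;> norm_num

/-- Second moment method: a spread family of small sets has a member inside a
`p`-biased random set with constant probability. The factor `2` in the spread condition leaves room
for the deletion of one member from a family that is spread with factor `1`. -/
theorem biasExp_miss_le {p R : ℝ} (hp₀ : 0 < p) (hp₁ : p ≤ 1) (hR : 0 < R) {d : ℕ}
    (hd : 2 * d ≤ p * R) (I : Finset κ) (v : κ → ℝ) (hv : ∀ i ∈ I, 0 ≤ v i) (T : κ → Finset ι)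
    (hT : ∀ i ∈ I, (T i).card ≤ d) (hpos : 0 < ∑ i ∈ I, v i)
    (hspread : ∀ A : Finset ι, R ^ A.card * ∑ i ∈ I with A ⊆ T i, v i ≤ 2 * ∑ i ∈ I, v i) :
    biasExp p (fun x => if ∃ i ∈ I, ∀ j ∈ T i, x j = true then 0 else 1) ≤ 3 / 4 := by
  set V := ∑ i ∈ I, v i with hV
  let ind (A : Finset ι) (x : ι → Bool) : ℝ := if ∀ j ∈ A, x j = true then 1 else 0
  let X (x : ι → Bool) : ℝ := ∑ i ∈ I, v i * p⁻¹ ^ (T i).card * ind (T i) x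
  have hind : ∀ A, biasExp p (ind A) = p ^ A.card := fun A => biasExp_forall_mem p A
  have hEX : biasExp p X = V := by
    simp only [X, biasExp_sum, biasExp_const_mul, hind]
    refine sum_congr rfl fun i _ => ?_
    rw [mul_assoc, ← mul_pow, inv_mul_cancel₀ hp₀.ne', one_pow, mul_one]
  have hEX2 : biasExp p (fun x => X x ^ 2) ≤ 4 * V ^ 2 := by
    have h1 : ∀ x, X x ^ 2 = ∑ i ∈ I, ∑ i' ∈ I,
        v i * v i' * p⁻¹ ^ ((T i).card + (T i').card) * ind (T i ∪ T i') x := by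
      intro x
      simp only [X, sq, sum_mul_sum]
      refine sum_congr rfl fun i _ => sum_congr rfl fun i' _ => ?_
      have : ind (T i ∪ T i') x = ind (T i) x * ind (T i') x := by
        simp only [ind, mem_union, or_imp, forall_and]
        split_ifs <;> simp_all
      rw [this]; ring
    have h2 : ∀ i i', v i * v i' * p⁻¹ ^ ((T i).card + (T i').card) * p ^ (T i ∪ T i').card =
        v i * (v i' * (1 + (p⁻¹ - 1)) ^ (T i ∩ T i').card) := by
      intro i i'
      rw [← card_union_add_card_inter, pow_add, add_sub_cancel]
      have : p⁻¹ ^ (T i ∪ T i').card * p ^ (T i ∪ T i').card = 1 := by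
        rw [← mul_pow, inv_mul_cancel₀ hp₀.ne', one_pow]
      linear_combination v i * v i' * p⁻¹ ^ (T i ∩ T i').card * this
    have hs : 0 ≤ p⁻¹ - 1 := by linarith [(one_le_inv₀ hp₀).2 hp₁]
    have h3 : ∀ i ∈ I, (1 + (p⁻¹ - 1) / R) ^ (T i).card ≤ 2 := by
      intro i hi
      have ha : 0 ≤ (p⁻¹ - 1) / R := div_nonneg hs hR.le
      have hle : (d : ℝ) * ((p⁻¹ - 1) / R) ≤ 1 / 2 := by
        have : (p⁻¹ - 1) / R ≤ 1 / (p * R) := by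
          rw [one_div, mul_inv, div_eq_mul_inv]
          exact mul_le_mul_of_nonneg_right (by linarith) (inv_nonneg.2 hR.le)
        calc (d : ℝ) * ((p⁻¹ - 1) / R) ≤ d * (1 / (p * R)) := by gcongr
          _ = d / (p * R) := by ring
          _ ≤ 1 / 2 := by rw [div_le_iff₀ (by positivity)]; linarith
      calc (1 + (p⁻¹ - 1) / R) ^ (T i).card ≤ (1 + (p⁻¹ - 1) / R) ^ d :=
            pow_le_pow_right₀ (by linarith) (hT i hi)
        _ ≤ Real.exp ((p⁻¹ - 1) / R) ^ d := by
            gcongr; rw [add_comm]; exact Real.add_one_le_exp _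
        _ = Real.exp (d * ((p⁻¹ - 1) / R)) := (Real.exp_nat_mul _ _).symm
        _ ≤ Real.exp (1 / 2) := Real.exp_le_exp.2 hle
        _ ≤ 2 := by
            have := Real.one_sub_le_exp_neg (1 / 2)
            rw [Real.exp_neg] at this
            rw [← inv_inv (Real.exp (1 / 2))]
            exact inv_le_of_inv_le₀ (by norm_num) (by linarith)
    simp only [h1, biasExp_sum, biasExp_const_mul, hind, h2, ← mul_sum]
    calc ∑ i ∈ I, v i * ∑ i' ∈ I, v i' * (1 + (p⁻¹ - 1)) ^ (T i ∩ T i').card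
        ≤ ∑ i ∈ I, v i * (2 * (2 * V)) := by
          refine sum_le_sum fun i hi => mul_le_mul_of_nonneg_left ?_ (hv i hi)
          refine (sum_pow_inter_le hR hs I v T hspread (T i)).trans ?_
          exact mul_le_mul_of_nonneg_right (h3 i hi) (by linarith)
      _ = 4 * V ^ 2 := by rw [← sum_mul, ← hV]; ring
  set M : (ι → Bool) → ℝ := fun x => if ∃ i ∈ I, ∀ j ∈ T i, x j = true then 0 else 1 with hM
  have hw : ∀ x : ι → Bool, 0 ≤ ∏ j, bitProb p (x j) := fun x =>
    prod_nonneg fun _ _ => bitProb_nonneg hp₀.le hp₁ _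
  have hM1 : ∀ x, M x ≤ 1 := fun x => by simp only [hM]; split_ifs <;> norm_num
  -- Cauchy-Schwarz on the event that the family is hit, off which `X` vanishes.
  have hCS : biasExp p X ^ 2 ≤ biasExp p (fun x => 1 - M x) * biasExp p (fun x => X x ^ 2) := by
    refine sum_sq_le_sum_mul_sum_of_sq_le_mul _ (fun x _ => mul_nonneg (hw x) (by linarith [hM1 x]))
      (fun x _ => mul_nonneg (hw x) (sq_nonneg _)) fun x _ => le_of_eq ?_
    by_cases h : ∃ i ∈ I, ∀ j ∈ T i, x j = true
    · simp only [hM, if_pos h]; ring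
    · have : X x = 0 := sum_eq_zero fun i hi => by
        have : ¬ ∀ j ∈ T i, x j = true := fun h' => h ⟨i, hi, h'⟩
        simp only [ind, if_neg this, mul_zero]
      simp [this]
  have hsub : biasExp p (fun x => 1 - M x) = 1 - biasExp p M := by
    conv_rhs => rw [← biasExp_one (ι := ι) p]
    simp only [biasExp, ← sum_sub_distrib, mul_sub]
  have hnn : 0 ≤ biasExp p (fun x => 1 - M x) :=
    sum_nonneg fun x _ => mul_nonneg (hw x) (by linarith [hM1 x])
  rw [hEX] at hCS
  have h4 : V ^ 2 ≤ (1 - biasExp p M) * (4 * V ^ 2) := by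
    rw [← hsub]; exact hCS.trans (mul_le_mul_of_nonneg_left hEX2 hnn)
  have h5 : 0 < V ^ 2 := by positivity
  by_contra! hc
  nlinarith

/-- A spread family of small sets is missed by a uniformly random set with exponentially small
probability: the random set is the union of `k` independent sparse ones, of which each hits the
family with constant probability. -/
theorem expect_miss_le {R : ℝ} (hR : 0 < R) {d k : ℕ} (hk : 0 < k) (hd : 4 * d * k ≤ R)
    (I : Finset κ) (v : κ → ℝ) (hv : ∀ i ∈ I, 0 ≤ v i) (T : κ → Finset ι)
    (hT : ∀ i ∈ I, (T i).card ≤ d) (hpos : 0 < ∑ i ∈ I, v i)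
    (hspread : ∀ A : Finset ι, R ^ A.card * ∑ i ∈ I with A ⊆ T i, v i ≤ 2 * ∑ i ∈ I, v i) :
    univ.expect (fun x : ι → Bool => if ∃ i ∈ I, ∀ j ∈ T i, x j = true then (0 : ℝ) else 1) ≤
      (3 / 4) ^ k := by
  have hk' : (0 : ℝ) < k := by exact_mod_cast hk
  have hk1 : (1 : ℝ) ≤ k := by exact_mod_cast hk
  -- The bias `p = 1 - 2 ^ (-1 / k)` makes the union of `k` independent sets `1 / 2`-biased.
  set q : ℝ := (1 / 2) ^ (k : ℝ)⁻¹ with hq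
  have hq₀ : 0 < q := by positivity
  have hqk : q ^ k = 1 / 2 := Real.rpow_inv_natCast_pow (by norm_num) hk.ne'
  have hq₁ : q ≤ 1 - 1 / (2 * k) := by
    have h0 : 0 ≤ 1 - 1 / (2 * (k : ℝ)) := by
      rw [sub_nonneg, div_le_one (by positivity)]; linarith
    refine le_of_pow_le_pow_left₀ hk.ne' h0 ?_
    rw [hqk]
    have := one_add_mul_le_pow (a := -(1 / (2 * (k : ℝ)))) (by linarith) k
    calc (1 / 2 : ℝ) = 1 + k * -(1 / (2 * (k : ℝ))) := by field_simp; norm_num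
      _ ≤ _ := by rw [sub_eq_add_neg]; exact this
  have hp₀ : 0 < 1 - q := by
    have : 0 < 1 / (2 * (k : ℝ)) := by positivity
    linarith
  have hd' : 2 * d ≤ (1 - q) * R := by
    calc (2 * d : ℝ) = 1 / (2 * k) * (4 * d * k) := by field_simp; ring
      _ ≤ 1 / (2 * k) * R := by gcongr
      _ ≤ (1 - q) * R := by gcongr; linarith
  have h1 := biasExp_miss_le hp₀ (by linarith) hR hd' I v hv T hT hpos hspread
  have h2 := biasExp_miss_pow hp₀.le (by linarith) I T k
  rw [sub_sub_cancel, hqk, show (1 - 1 / 2 : ℝ) = 1 / 2 by norm_num, biasExp_half] at h2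
  refine h2.trans (pow_le_pow_left₀ ?_ h1 k)
  refine biasExp_nonneg hp₀.le (by linarith) fun x => ?_
  split_ifs <;> norm_num

/-- Every weighted set family has a kernel, lying in members of not too small total weight, such
that these members are spread outside it. It is found by maximizing `R ^ |K|` times the weight
above `K`, which makes the weight above `K ∪ A` at most `R ^ (-|A|)` times that above `K`. -/
theorem exists_spread_kernel (R : ℝ) (I : Finset κ) (v : κ → ℝ) (T : κ → Finset ι) :
    ∃ K : Finset ι, ∑ i ∈ I, v i ≤ R ^ K.card * ∑ i ∈ I with K ⊆ T i, v i ∧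
      ∀ A, R ^ A.card * ∑ i ∈ I with A ⊆ T i, v i ≤ R ^ K.card * ∑ i ∈ I with K ⊆ T i, v i := by
  obtain ⟨K, -, hK⟩ := exists_max_image (univ : Finset (Finset ι))
    (fun A => R ^ A.card * ∑ i ∈ I with A ⊆ T i, v i) univ_nonempty
  exact ⟨K, by simpa using hK ∅ (mem_univ _), fun A => hK A (mem_univ _)⟩

end Biased

/-! ### The overlap with the unit vectors -/

/-- The set of positions at which a uniformly random string agrees with `y` is uniform. -/
theorem expect_beq {ι : Type*} [Fintype ι] [DecidableEq ι] (y : ι → Bool)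
    (F : (ι → Bool) → ℝ) : 𝔼 z : ι → Bool, F (fun j => z j == y j) = 𝔼 x, F x := by
  have h : Function.Involutive fun (z : ι → Bool) j => z j == y j := by
    intro z
    funext j
    show ((z j == y j) == y j) = z j
    cases z j <;> cases y j <;> rfl
  exact Fintype.expect_equiv (h.toPerm _) _ _ fun _ => rfl

theorem expect_agree {m : ℕ} (z : Fin m → Bool) (A : Finset (Fin m)) :
    𝔼 y : Fin m → Bool, (if ∀ j ∈ A, y j = z j then (1 : ℝ) else 0) = (1 / 2) ^ A.card := by
  have h := expect_beq z fun x => if ∀ j ∈ A, x j = true then (1 : ℝ) else 0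
  simp only [beq_iff_eq] at h
  rw [← biasExp_forall_mem, biasExp_half]
  convert h

section Overlap

variable {m n : ℕ}

/-- The probability that the decision forest `T`, run on uniform input bits, outputs the unit
vector `e i`. -/
noncomputable def unitProb (T : Fin n → DecisionTree m) (i : Fin n) : ℝ :=
  𝔼 z : Fin m → Bool, if (∀ l, (T l).eval z = decide (l = i)) then 1 else 0

/-- The probability that the forest `T` outputs the unit vector `e i` on an input that agrees with
`y` on the bits which the `i`-th tree reads on `y`. -/
noncomputable def unitProbNear (T : Fin n → DecisionTree m) (y : Fin m → Bool) (i : Fin n) : ℝ :=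
  𝔼 z : Fin m → Bool,
    if (∀ l, (T l).eval z = decide (l = i)) ∧ ∀ j ∈ (T i).queries y, z j = y j then 1 else 0

theorem unitProbNear_nonneg (T : Fin n → DecisionTree m) (y : Fin m → Bool) (i : Fin n) :
    0 ≤ unitProbNear T y i :=
  expect_nonneg fun z _ => by split_ifs <;> norm_num

theorem unitProbNear_le (T : Fin n → DecisionTree m) (y : Fin m → Bool) (i : Fin n) :
    unitProbNear T y i ≤ unitProb T i :=
  expect_le_expect fun z _ => by split_ifs <;> first | tauto | norm_num

theorem unitProbNear_eq_zero (T : Fin n → DecisionTree m) (y : Fin m → Bool) (i : Fin n)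
    (h : (T i).eval y ≠ true) : unitProbNear T y i = 0 :=
  expect_eq_zero fun z _ => if_neg fun ⟨h1, h2⟩ => h <| by
    rw [← ((T i).queries_eval_congr h2).2, h1 i, decide_eq_true rfl]

/-- A random input `y` agrees with a fixed `z` on the bits that the tree reads on `z` with
probability at least `2⁻ᵈ`, and then the tree reads the same bits on `y`. -/
theorem unitProb_le_expect_near (T : Fin n → DecisionTree m) {d : ℕ} (i : Fin n)
    (hd : (T i).depth ≤ d) :
    (1 / 2) ^ d * unitProb T i ≤ 𝔼 y, unitProbNear T y i := by
  unfold unitProb unitProbNear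
  rw [expect_comm, mul_expect]
  refine expect_le_expect fun z _ => ?_
  by_cases hz : ∀ l, (T l).eval z = decide (l = i)
  · rw [if_pos hz, mul_one]
    calc (1 / 2 : ℝ) ^ d ≤ (1 / 2) ^ ((T i).queries z).card :=
          pow_le_pow_of_le_one (by norm_num) (by norm_num) (((T i).card_queries_le z).trans hd)
      _ = 𝔼 y : Fin m → Bool, (if ∀ j ∈ (T i).queries z, y j = z j then (1 : ℝ) else 0) :=
          (expect_agree z _).symm
      _ ≤ _ := by
          refine expect_le_expect fun y _ => ?_
          by_cases h : ∀ j ∈ (T i).queries z, y j = z j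
          · rw [if_pos h, if_pos]
            refine ⟨hz, fun j hj => ?_⟩
            rw [((T i).queries_eval_congr h).1] at hj
            exact (h j hj).symm
          · rw [if_neg h]; split_ifs <;> norm_num
  · rw [if_neg hz, mul_zero]
    exact expect_nonneg fun y _ => by split_ifs <;> norm_num

/-- The overlap of the output distribution of a shallow decision forest with the uniform
distribution on unit vectors is at most `2 (2 R) ^ d / n`. -/
theorem sum_min_unitProb_le (T : Fin n → DecisionTree m) {d k : ℕ} {R : ℝ}
    (hT : ∀ i, (T i).depth ≤ d) (hn : 0 < n) (hk : 0 < k) (hR : 1 ≤ R) (hdk : 4 * d * k ≤ R)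
    (hnk : (n : ℝ) ^ 2 * (3 / 4) ^ k ≤ 2) :
    ∑ i, min (unitProb T i) (1 / n) ≤ 2 * (2 * R) ^ d / n := by
  by_contra! hδ
  have hn' : (0 : ℝ) < n := by exact_mod_cast hn
  have hR₀ : 0 < R := by linarith
  have hp : ∀ i, 0 ≤ unitProb T i := fun i => expect_nonneg fun z _ => by split_ifs <;> norm_num
  -- Scaling by `b i` caps the contribution of each index at `1 / n`.
  set b : Fin n → ℝ := fun i => min (unitProb T i) (1 / n) / unitProb T i with hb
  have hb₀ : ∀ i, 0 ≤ b i := fun i => div_nonneg (le_min (hp i) (by positivity)) (hp i)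
  have hb₁ : ∀ i, b i ≤ 1 := fun i => div_le_one_of_le₀ (min_le_left _ _) (hp i)
  have hbp : ∀ i, b i * unitProb T i = min (unitProb T i) (1 / n) := by
    intro i
    rcases (hp i).eq_or_lt with h | h
    · rw [← h, mul_zero, min_eq_left (by positivity)]
    · exact div_mul_cancel₀ _ h.ne'
  obtain ⟨y, hy⟩ : ∃ y, (1 / 2) ^ d * ∑ i, min (unitProb T i) (1 / n) ≤
      ∑ i, b i * unitProbNear T y i := by
    have h : (1 / 2) ^ d * ∑ i, min (unitProb T i) (1 / n) ≤
        𝔼 y, ∑ i, b i * unitProbNear T y i := by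
      rw [expect_sum_comm, mul_sum]
      refine sum_le_sum fun i _ => ?_
      rw [← mul_expect, ← hbp, mul_left_comm]
      exact mul_le_mul_of_nonneg_left (unitProb_le_expect_near T i (hT i)) (hb₀ i)
    obtain ⟨y, -, hy⟩ := exists_le_of_le_expect univ_nonempty h
    exact ⟨y, hy⟩
  set v : Fin n → ℝ := fun i => b i * unitProbNear T y i with hv
  have hv₀ : ∀ i, 0 ≤ v i := fun i => mul_nonneg (hb₀ i) (unitProbNear_nonneg T y i)
  have hvw : ∀ i, v i ≤ unitProbNear T y i := fun i =>
    mul_le_of_le_one_left (unitProbNear_nonneg T y i) (hb₁ i)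
  have hvn : ∀ i, v i ≤ 1 / n := fun i =>
    ((mul_le_mul_of_nonneg_left (unitProbNear_le T y i) (hb₀ i)).trans_eq (hbp i)).trans
      (min_le_right _ _)
  set I₀ : Finset (Fin n) := {i | (T i).eval y = true} with hI₀
  have hsum : ∑ i, v i = ∑ i ∈ I₀, v i := by
    refine (sum_subset (subset_univ _) fun i _ hi => ?_).symm
    simp only [hv, unitProbNear_eq_zero T y i (by simpa [hI₀] using hi), mul_zero]
  obtain ⟨K, hK, hspread⟩ := exists_spread_kernel R I₀ v fun i => (T i).queries y
  set I : Finset (Fin n) := {i ∈ I₀ | K ⊆ (T i).queries y} with hI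
  rw [← hsum] at hK
  set V : ℝ := ∑ i ∈ I, v i with hV
  have hVn : 2 / n < V := by
    have hδ₀ : 0 < ∑ i, min (unitProb T i) (1 / n) := lt_of_le_of_lt (by positivity) hδ
    have h1 : 0 < R ^ K.card * V := lt_of_lt_of_le (by positivity) (hy.trans hK)
    have hV₀ : 0 < V := pos_of_mul_pos_right h1 (by positivity)
    obtain ⟨i, hi, -⟩ := exists_ne_zero_of_sum_ne_zero hV₀.ne'
    have hKd : K.card ≤ d := (card_le_card (mem_filter.1 hi).2).trans
      (((T i).card_queries_le y).trans (hT i))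
    have h2 : (1 / 2) ^ d * ∑ i, min (unitProb T i) (1 / n) ≤ R ^ d * V :=
      (hy.trans hK).trans (mul_le_mul_of_nonneg_right (pow_le_pow_right₀ hR hKd) hV₀.le)
    have h3 : (1 / 2 : ℝ) ^ d * (2 * (2 * R) ^ d / n) < R ^ d * V :=
      lt_of_lt_of_le (mul_lt_mul_of_pos_left hδ (by positivity)) h2
    have h4 : (1 / 2 : ℝ) ^ d * (2 * (2 * R) ^ d / n) = R ^ d * (2 / n) := by
      have : (1 / 2 : ℝ) ^ d * 2 ^ d = 1 := by rw [← mul_pow]; norm_num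
      rw [mul_pow]
      linear_combination (2 * R ^ d / n) * this
    rw [h4] at h3
    exact lt_of_mul_lt_mul_left h3 (by positivity)
  -- An input counted by `unitProbNear T y i` agrees with `y` on the kernel, yet it satisfies none
  -- of the other certificates above the kernel.
  have hsmall : ∀ i ∈ I, unitProbNear T y i ≤ (3 / 4) ^ k := by
    intro i hi
    have hVi : V ≤ 2 * ∑ l ∈ I.erase i, v l := by
      have := sum_erase_add I v hi
      have h1 := hvn i
      have h2 : (2 : ℝ) / n = 2 * (1 / n) := by ring
      linarith
    refine le_trans ?_ (expect_miss_le hR₀ hk hdk (I.erase i) v (fun l _ => hv₀ l)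
      (fun l => (T l).queries y \ K) (fun l _ => (card_le_card sdiff_subset).trans
        (((T l).card_queries_le y).trans (hT l)))
      (by have : 0 < 2 / (n : ℝ) := by positivity
          linarith) fun A => le_trans ?_ hVi)
    · rw [← expect_beq y]
      refine expect_le_expect fun z _ => ?_
      by_cases h : (∀ l, (T l).eval z = decide (l = i)) ∧ ∀ j ∈ (T i).queries y, z j = y j
      · rw [if_pos h, if_neg]
        rintro ⟨l, hl, hlz⟩
        obtain ⟨hli, hl⟩ := mem_erase.1 hl
        have hlI := mem_filter.1 hl
        have hagree : ∀ j ∈ (T l).queries y, z j = y j := by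
          intro j hj
          by_cases hjK : j ∈ K
          · exact h.2 j ((mem_filter.1 hi).2 hjK)
          · simpa using hlz j (mem_sdiff.2 ⟨hj, hjK⟩)
        have h1 := ((T l).queries_eval_congr hagree).2
        rw [h.1 l, decide_eq_false hli, (mem_filter.1 hlI.1).2] at h1
        exact Bool.false_ne_true h1
      · rw [if_neg h]; split_ifs <;> norm_num
    · by_cases hA : Disjoint A K
      · have h1 := hspread (A ∪ K)
        rw [card_union_of_disjoint hA, pow_add, mul_comm (R ^ A.card), mul_assoc] at h1
        refine le_trans ?_ (le_of_mul_le_mul_left h1 (by positivity))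
        refine mul_le_mul_of_nonneg_left ?_ (by positivity)
        refine sum_le_sum_of_subset_of_nonneg (fun l hl => ?_) fun l _ _ => hv₀ l
        obtain ⟨hl, hAl⟩ := mem_filter.1 hl
        obtain ⟨hl₀, hKl⟩ := mem_filter.1 (mem_of_mem_erase hl)
        exact mem_filter.2 ⟨hl₀, union_subset (hAl.trans sdiff_subset) hKl⟩
      · rw [filter_false_of_mem, sum_empty, mul_zero]
        · exact sum_nonneg fun l _ => hv₀ l
        · exact fun l _ hAl => hA (disjoint_of_subset_left hAl sdiff_disjoint)
  have hVle : V ≤ n * (3 / 4) ^ k := by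
    calc V ≤ ∑ i ∈ I, (3 / 4 : ℝ) ^ k := sum_le_sum fun i hi => (hvw i).trans (hsmall i hi)
      _ = I.card * (3 / 4) ^ k := by rw [sum_const, nsmul_eq_mul]
      _ ≤ n * (3 / 4) ^ k := by
          gcongr
          simpa using card_le_univ I
  have h1 := (div_lt_iff₀ hn').1 (hVn.trans_le hVle)
  nlinarith

end Overlap

/-! ### Statistical distance from the uniform distribution on unit vectors -/

section StatDist

theorem statDist_eq_one_sub {α : Type*} [Fintype α] (p q : PMF α) :
    statDist p q = 1 - ∑ a, min (p a).toReal (q a).toReal := by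
  have hone : ∀ r : PMF α, ∑ a, (r a).toReal = 1 := by
    intro r
    have h := r.tsum_coe
    rw [tsum_fintype] at h
    rw [← ENNReal.toReal_sum fun a _ => r.apply_ne_top a, h, ENNReal.toReal_one]
  have h : ∀ a, |(p a).toReal - (q a).toReal| =
      (p a).toReal + (q a).toReal - 2 * min (p a).toReal (q a).toReal := by
    intro a
    rcases le_total (p a).toReal (q a).toReal with h | h
    · rw [min_eq_left h, abs_of_nonpos (by linarith)]; ring
    · rw [min_eq_right h, abs_of_nonneg (by linarith)]; ring
  simp only [statDist, h, sum_sub_distrib, sum_add_distrib, hone, ← mul_sum]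
  ring

theorem bitSlice_one_eq_image (n : ℕ) :
    bitSlice n 1 = univ.image fun i j : Fin n => decide (j = i) := by
  ext x
  simp only [bitSlice, bitWeight, mem_filter, mem_univ, true_and, mem_image, card_eq_one]
  refine exists_congr fun i => ?_
  simp only [Finset.ext_iff, mem_filter, mem_univ, true_and, mem_singleton, funext_iff]
  refine forall_congr' fun j => ?_
  by_cases h : j = i <;> cases hx : x j <;> simp [h]

theorem decide_eq_injective (n : ℕ) :
    Function.Injective fun i j : Fin n => decide (j = i) := by
  intro i i' h
  simpa using congrFun h i

theorem statDist_uniformSlice_one {n : ℕ} (hn : 1 ≤ n) (p : PMF (Fin n → Bool)) :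
    statDist p (uniformSlice n 1 hn) =
      1 - ∑ i, min (p fun j => decide (j = i)).toReal (1 / n) := by
  rw [statDist_eq_one_sub, ← sum_subset (subset_univ (bitSlice n 1)), bitSlice_one_eq_image,
    sum_image (decide_eq_injective n).injOn]
  · congr 1
    refine sum_congr rfl fun i _ => ?_
    rw [uniformSlice, PMF.uniformOfFinset_apply_of_mem, bitSlice_one_eq_image,
      card_image_of_injective _ (decide_eq_injective n)]
    · simp
    · rw [bitSlice_one_eq_image]; exact mem_image_of_mem _ (mem_univ i)
  · intro a _ ha
    rw [uniformSlice, PMF.uniformOfFinset_apply_of_notMem _ ha, ENNReal.toReal_zero,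
      min_eq_right ENNReal.toReal_nonneg]

theorem map_uniform_unit {m n : ℕ} {f : (Fin m → Bool) → (Fin n → Bool)}
    {T : Fin n → DecisionTree m} (hf : ∀ i x, f x i = (T i).eval x) (i : Fin n) :
    ((PMF.uniformOfFintype (Fin m → Bool)).map f fun j => decide (j = i)).toReal =
      unitProb T i := by
  have hiff : ∀ z, ((fun j => decide (j = i)) = f z ↔ ∀ l, (T l).eval z = decide (l = i)) := by
    intro z
    simp only [funext_iff, hf, eq_comm]
  rw [PMF.map_apply, tsum_fintype, ENNReal.toReal_sum, unitProb, Fintype.expect_eq_sum_div_card,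
    sum_div]
  · refine sum_congr rfl fun z _ => ?_
    simp only [hiff, PMF.uniformOfFintype_apply]
    split_ifs <;> simp
  · intro z _
    split_ifs
    · exact PMF.apply_ne_top _ _
    · exact ENNReal.zero_ne_top

end StatDist

/-! ### Choice of the parameters -/

section Numerics

theorem log_three_gt : (1.02 : ℝ) < Real.log 3 := by
  have h1 := Real.log_two_gt_d9
  have h2 := Real.one_sub_inv_le_log_of_pos (x := 3 / 2) (by norm_num)
  have h3 : Real.log 3 = Real.log 2 + Real.log (3 / 2) := by
    rw [← Real.log_mul (by norm_num) (by norm_num)]; norm_num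
  rw [h3]; norm_num at h1 h2 ⊢; linarith

theorem sq_mul_three_quarters_pow_le {n k : ℕ} (hn : 0 < n) (hk : 12 * Real.log n ≤ k) :
    (n : ℝ) ^ 2 * (3 / 4) ^ k ≤ 2 := by
  have hn' : (0 : ℝ) < n := by exact_mod_cast hn
  have hL : 0 ≤ Real.log n := Real.log_natCast_nonneg n
  have h1 : (3 / 4 : ℝ) ≤ Real.exp (-(1 / 4)) := by
    linarith [Real.one_sub_le_exp_neg (1 / 4)]
  calc (n : ℝ) ^ 2 * (3 / 4) ^ k ≤ Real.exp (Real.log n) ^ 2 * Real.exp (-(1 / 4)) ^ k := by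
        rw [Real.exp_log hn']; gcongr
    _ = Real.exp (2 * Real.log n + k * -(1 / 4)) := by
        rw [← Real.exp_nat_mul, ← Real.exp_nat_mul, ← Real.exp_add]; norm_num
    _ ≤ Real.exp 0 := Real.exp_le_exp.2 (by linarith)
    _ ≤ 2 := by rw [Real.exp_zero]; norm_num

theorem two_mul_pow_le {n d k : ℕ} (hn : 3 ≤ n)
    (hd : (d : ℝ) ≤ 1 / 1000 * Real.log n / Real.log (Real.log n))
    (hk : (k : ℝ) ≤ 12 * Real.log n + 1) :
    2 * (2 * (4 * (d + 1) * k)) ^ d ≤ (n : ℝ) ^ (3 / 4 : ℝ) := by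
  have hn' : (3 : ℝ) ≤ n := by exact_mod_cast hn
  have hn₀ : (0 : ℝ) < n := by linarith
  rcases Nat.eq_zero_or_pos d with rfl | hd₀
  · rw [pow_zero, mul_one]
    refine le_trans ?_ (Real.rpow_le_rpow (by norm_num) hn' (by norm_num))
    refine le_of_pow_le_pow_left₀ (n := 4) (by norm_num) (by positivity) ?_
    rw [← Real.rpow_natCast, ← Real.rpow_natCast, ← Real.rpow_mul (by norm_num)]
    norm_num
  set L := Real.log n with hL
  have hL₁ : 1.02 < L := log_three_gt.trans_le (Real.log_le_log (by norm_num) hn')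
  have hL₀ : 0 < L := by linarith
  have hl : 0 < Real.log L := Real.log_pos (by linarith)
  have hdl : d * Real.log L ≤ 1 / 1000 * L := (le_div_iff₀ hl).1 hd
  have hd₁ : (1 : ℝ) ≤ d := by exact_mod_cast hd₀
  -- The bound on `d` forces `1000 log L ≤ L`; as `L` stays away from `1`, it must be large.
  have hL₁₁ : 11 ≤ L := by
    have h1 := Real.one_sub_inv_le_log_of_pos hL₀
    have h2 : Real.log L ≤ 1 / 1000 * L := by nlinarith
    have h3 : L * L⁻¹ = 1 := mul_inv_cancel₀ hL₀.ne'
    by_contra! h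
    nlinarith
  have hl₁ : 1 - 1 / 11 ≤ Real.log L := by
    have h1 := Real.one_sub_inv_le_log_of_pos hL₀
    have h2 : L⁻¹ ≤ 11⁻¹ := inv_anti₀ (by norm_num) hL₁₁
    norm_num at h2 ⊢; linarith
  have hdL : (d : ℝ) + 1 ≤ 2 * L := by nlinarith
  have hbase : 2 * (4 * ((d : ℝ) + 1) * k) ≤ L ^ 5 := by
    have h1 : (k : ℝ) ≤ 13 * L := by linarith
    calc 2 * (4 * ((d : ℝ) + 1) * k) ≤ 2 * (4 * (2 * L) * (13 * L)) := by gcongr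
      _ = 208 * L ^ 2 := by ring
      _ ≤ 11 ^ 3 * L ^ 2 := by gcongr; norm_num
      _ ≤ L ^ 3 * L ^ 2 := by gcongr
      _ = L ^ 5 := by ring
  calc 2 * (2 * (4 * ((d : ℝ) + 1) * k)) ^ d ≤ Real.exp 1 * (L ^ 5) ^ d := by
        gcongr
        linarith [Real.add_one_le_exp 1]
    _ = Real.exp 1 * (Real.exp (Real.log L) ^ 5) ^ d := by rw [Real.exp_log hL₀]
    _ = Real.exp (1 + d * (5 * Real.log L)) := by
        rw [← Real.exp_nat_mul, ← Real.exp_nat_mul, ← Real.exp_add]; norm_num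
    _ ≤ Real.exp (L * (3 / 4)) := Real.exp_le_exp.2 (by nlinarith)
    _ = (n : ℝ) ^ (3 / 4 : ℝ) := (Real.rpow_def_of_pos hn₀ _).symm

end Numerics

theorem theorem2 :
    ∃ τ : ℝ, 0 < τ ∧ ∃ c : ℝ, 0 < c ∧
      ∀ (n : ℕ) (hn : 3 ≤ n) (d : ℕ),
        (d : ℝ) ≤ τ * Real.log (n : ℝ) / Real.log (Real.log (n : ℝ)) →
        ∀ p : PMF (Fin n → Bool), SampledWithDecisionDepth p d →
          1 - (n : ℝ) ^ (-c) ≤ statDist p (uniformSlice n 1 (le_trans (by norm_num) hn)) := by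
  refine ⟨1 / 1000, by norm_num, 1 / 4, by norm_num, ?_⟩
  rintro n hn d hd p ⟨m, f, ⟨T, hT⟩, rfl⟩
  have hn' : (3 : ℝ) ≤ n := by exact_mod_cast hn
  have hn₀ : (0 : ℝ) < n := by linarith
  have hL : 0 < Real.log n := Real.log_pos (by linarith)
  set k := ⌈12 * Real.log n⌉₊ with hk
  have hk₀ : 0 < k := Nat.ceil_pos.2 (by linarith)
  have hk₁ : (1 : ℝ) ≤ k := by exact_mod_cast hk₀
  have hd₀ : (0 : ℝ) ≤ d := d.cast_nonneg
  have hover := sum_min_unitProb_le T (d := d) (k := k) (R := 4 * (d + 1) * k)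
    (fun i => (hT i).1) (by omega) hk₀ (by nlinarith) (by nlinarith)
    (sq_mul_three_quarters_pow_le (by omega) (Nat.le_ceil _))
  have hnum := two_mul_pow_le hn hd (Nat.ceil_lt_add_one (by linarith)).le
  rw [statDist_uniformSlice_one]
  simp only [map_uniform_unit fun i x => (hT i).2 x]
  have hfin : 2 * (2 * (4 * ((d : ℝ) + 1) * k)) ^ d / n ≤ (n : ℝ) ^ (-(1 / 4) : ℝ) := by
    rw [div_le_iff₀ hn₀]
    refine hnum.trans_eq ?_
    nth_rw 3 [← Real.rpow_one (n : ℝ)]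
    rw [← Real.rpow_add hn₀]
    norm_num
  linarith
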